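/- For complex $a,q$ and an integer $n\ge 0$ let $(a;q)_n=\prod_{j=0}^{n-1}(1-aq^{j})$, for $|q|<1$ let $(a;q)_\infty=\prod_{j=0}^{\infty}(1-aq^{j})$, and let ${n \brack k}_q=\dfrac{(q;q)_n}{(q;q)_k\,(q;q)_{n-k}}$ for integers $0\le k\le n$. Then for every complex number $q$ with $|q|<1$, $$\sum_{n=0}^{\infty}\ \sum_{m=-\lfloor n/2\rfloor}^{\lfloor n/2\rfloor}\frac{(-1)^m q^{\,n(n+1)+m(9m+1)/2}\,(-1;q^2)_n}{(q^2;q^2)_{2n}}{2n \brack n-2m}_{q^2}=\frac{2(-q^2;q^2)_\infty}{(q^2;q^2)_\infty}\sum_{n=-\infty}^{\infty}\frac{(-1)^n q^{\,n(17n+5)/2}}{1+q^{4n}},$$ where the infinite products, the outer series over $n$ on the left and the bilateral series on the right all converge absolutely. (For $q=0$ the terms with $n<0$ on the right are read as $0$, their limit as $q\to0$.) -/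

import Mathlib

/-- The finite `q`-shifted factorial `(a; q)_n = ∏_{j=0}^{n-1} (1 - a q^j)`. -/
noncomputable def qPoch (a q : ℂ) (n : ℕ) : ℂ :=
  ∏ j ∈ Finset.range n, (1 - a * q ^ j)

/-- The infinite `q`-shifted factorial `(a; q)_∞ = ∏_{j ≥ 0} (1 - a q^j)`. -/
noncomputable def qPochInf (a q : ℂ) : ℂ :=
  ∏' j : ℕ, (1 - a * q ^ j)

/-- The `q`-binomial coefficient `(q; q)_n / ((q; q)_k (q; q)_{n-k})`,
equal to zero unless `0 ≤ k ≤ n`. -/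
noncomputable def qBinom (q : ℂ) (n : ℕ) (k : ℤ) : ℂ :=
  if 0 ≤ k ∧ k ≤ (n : ℤ) then
    qPoch q q n / (qPoch q q k.toNat * qPoch q q (n - k.toNat))
  else 0

open Filter Topology

/-! Writing the `q`-binomial over `(q²;q²)_{2n}` as `1/((q²;q²)_{n-2m} (q²;q²)_{n+2m})` turns the
left side into an absolutely convergent double series. Interchanging the sums leaves, for each `m`,
a sum over `n` with `r = 2|m|`: the conjugate Bailey pair `hasSum_conjTerm`, a case of the `₁φ₁` sum
`tsum_phiTerm`. It yields the infinite products times `q^(r(r+1))/(1+q^(2r))`, and `mul_pow_div_eq`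
matches the exponents. -/

/-! ### Shifted factorials: convergence and uniform bounds -/

lemma qPoch_zero (a q : ℂ) : qPoch a q 0 = 1 := by simp [qPoch]

lemma qPoch_succ (a q : ℂ) (n : ℕ) : qPoch a q (n + 1) = qPoch a q n * (1 - a * q ^ n) := by
  simp [qPoch, Finset.prod_range_succ]

lemma qPoch_add (a q : ℂ) (m n : ℕ) :
    qPoch a q (m + n) = qPoch a q m * qPoch (a * q ^ m) q n := by
  simp only [qPoch, Finset.prod_range_add, pow_add, mul_assoc]

lemma summable_norm_qPoch_factor (a : ℂ) {q : ℂ} (hq : ‖q‖ < 1) :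
    Summable fun j : ℕ => ‖-(a * q ^ j)‖ := by
  simpa only [norm_neg, norm_mul, norm_pow] using
    (summable_geometric_of_lt_one (norm_nonneg q) hq).mul_left ‖a‖

lemma multipliable_qPoch_factor (a : ℂ) {q : ℂ} (hq : ‖q‖ < 1) :
    Multipliable fun j : ℕ => 1 - a * q ^ j := by
  simpa only [sub_eq_add_neg] using
    multipliable_one_add_of_summable (summable_norm_qPoch_factor a hq)

lemma tendsto_qPoch (a : ℂ) {q : ℂ} (hq : ‖q‖ < 1) :
    Tendsto (qPoch a q) atTop (𝓝 (qPochInf a q)) :=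
  (multipliable_qPoch_factor a hq).tendsto_prod_tprod_nat

lemma qPoch_ne_zero {a q : ℂ} (h : ∀ j : ℕ, 1 - a * q ^ j ≠ 0) (n : ℕ) : qPoch a q n ≠ 0 :=
  Finset.prod_ne_zero_iff.mpr fun j _ => h j

lemma qPochInf_ne_zero {a q : ℂ} (hq : ‖q‖ < 1) (h : ∀ j : ℕ, 1 - a * q ^ j ≠ 0) :
    qPochInf a q ≠ 0 := by
  have := tprod_one_add_ne_zero_of_summable (f := fun j : ℕ => -(a * q ^ j))
    (fun j => by simpa only [sub_eq_add_neg] using h j) (summable_norm_qPoch_factor a hq)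
  simpa only [qPochInf, sub_eq_add_neg] using this

lemma qPochInf_eq_qPoch_mul (a : ℂ) {q : ℂ} (hq : ‖q‖ < 1) (m : ℕ) :
    qPochInf a q = qPoch a q m * qPochInf (a * q ^ m) q := by
  refine tendsto_nhds_unique ((tendsto_add_atTop_iff_nat m).mpr (tendsto_qPoch a hq)) ?_
  simpa only [add_comm _ m, qPoch_add] using (tendsto_qPoch (a * q ^ m) hq).const_mul (qPoch a q m)

lemma exists_norm_le_of_tendsto {u : ℕ → ℂ} {x : ℂ} (hu : Tendsto u atTop (𝓝 x)) :
    ∃ C, 0 < C ∧ ∀ n, ‖u n‖ ≤ C := by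
  obtain ⟨C, hC, h⟩ := (Metric.isBounded_range_of_tendsto u hu).exists_pos_norm_le
  exact ⟨C, hC, fun n => h _ ⟨n, rfl⟩⟩

lemma exists_norm_qPoch_le (a : ℂ) {q : ℂ} (hq : ‖q‖ < 1) :
    ∃ C, 0 < C ∧ ∀ n, ‖qPoch a q n‖ ≤ C :=
  exists_norm_le_of_tendsto (tendsto_qPoch a hq)

lemma exists_norm_inv_qPoch_le {a q : ℂ} (hq : ‖q‖ < 1) (h : ∀ j : ℕ, 1 - a * q ^ j ≠ 0) :
    ∃ C, 0 < C ∧ ∀ n, ‖(qPoch a q n)⁻¹‖ ≤ C :=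
  exists_norm_le_of_tendsto ((tendsto_qPoch a hq).inv₀ (qPochInf_ne_zero hq h))

lemma one_sub_mul_pow_ne_zero {a q : ℂ} (ha : ‖a‖ < 1) (hq : ‖q‖ < 1) (j : ℕ) :
    1 - a * q ^ j ≠ 0 := by
  intro h
  have h1 : ‖a * q ^ j‖ = 1 := by rw [← sub_eq_zero.mp h, norm_one]
  have h2 : ‖q ^ j‖ ≤ 1 := by rw [norm_pow]; exact pow_le_one₀ (norm_nonneg _) hq.le
  rw [norm_mul] at h1
  nlinarith [norm_nonneg a, norm_nonneg (q ^ j)]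

/-! ### The `₁φ₁` summation -/

/-- The general term of the series `₁φ₁(a; ab; q, b)`. -/
noncomputable def phiTerm (a b q : ℂ) (k : ℕ) : ℂ :=
  qPoch a q k / (qPoch q q k * qPoch (a * b) q k) * (-b) ^ k * q ^ k.choose 2

/-- Uniformity in `N` comes from `1/(abq^N;q)_k = (ab;q)_N/(ab;q)_{N+k}`; it supplies the dominating
series when `N → ∞`. -/
lemma exists_norm_phiTerm_le {a b q : ℂ} (hq : ‖q‖ < 1) (h : ∀ j : ℕ, 1 - a * b * q ^ j ≠ 0) :
    ∃ C, 0 < C ∧ ∀ N k : ℕ, ‖phiTerm a (b * q ^ N) q k‖ ≤ C * ‖b * q ^ N‖ ^ k := by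
  obtain ⟨A, hA, hA'⟩ := exists_norm_qPoch_le a hq
  obtain ⟨B, hB, hB'⟩ := exists_norm_inv_qPoch_le hq (one_sub_mul_pow_ne_zero hq hq)
  obtain ⟨D, hD, hD'⟩ := exists_norm_qPoch_le (a * b) hq
  obtain ⟨E, hE, hE'⟩ := exists_norm_inv_qPoch_le hq h
  refine ⟨A * (B * (D * E)), by positivity, fun N k => ?_⟩
  have key : (qPoch (a * (b * q ^ N)) q k)⁻¹ = qPoch (a * b) q N * (qPoch (a * b) q (N + k))⁻¹ := by
    rw [qPoch_add, ← mul_assoc a b, mul_inv, ← mul_assoc, mul_inv_cancel₀ (qPoch_ne_zero h N),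
      one_mul]
  have hk : ‖q ^ k.choose 2‖ ≤ 1 := by
    rw [norm_pow]; exact pow_le_one₀ (norm_nonneg _) hq.le
  rw [phiTerm, div_eq_mul_inv, mul_inv, key, norm_mul, norm_mul, norm_mul, norm_mul, norm_mul,
    norm_pow, norm_neg]
  refine (mul_le_of_le_one_right (by positivity) hk).trans ?_
  gcongr
  exacts [hA' k, hB' k, hD' N, hE' _]

lemma summable_phiTerm {a b q : ℂ} (hq : ‖q‖ < 1) (hb : ‖b‖ < 1)
    (h : ∀ j : ℕ, 1 - a * b * q ^ j ≠ 0) : Summable (phiTerm a b q) := by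
  obtain ⟨C, -, hC⟩ := exists_norm_phiTerm_le hq h
  refine Summable.of_norm_bounded
    ((summable_geometric_of_lt_one (norm_nonneg b) hb).mul_left C) fun k => ?_
  simpa using hC 0 k

lemma norm_mul_pow_lt_one {b q : ℂ} (hq : ‖q‖ < 1) (hb : ‖b‖ < 1) (N : ℕ) : ‖b * q ^ N‖ < 1 := by
  rw [norm_mul, norm_pow]
  exact (mul_le_of_le_one_right (norm_nonneg _) (pow_le_one₀ (norm_nonneg _) hq.le)).trans_lt hb

lemma phiTerm_telescope {a b q : ℂ} (hq : ‖q‖ < 1) (h : ∀ j : ℕ, 1 - a * b * q ^ j ≠ 0) (k : ℕ) :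
    (1 - a * b) * phiTerm a b q k - (1 - b) * phiTerm a (b * q) q k =
      (-(1 - a * b) * phiTerm a b q (k + 1) * (1 - q ^ (k + 1))) -
      (-(1 - a * b) * phiTerm a b q k * (1 - q ^ k)) := by
  have h0 : 1 - a * b ≠ 0 := by simpa using h 0
  have hk := h k
  have hQ := qPoch_ne_zero (one_sub_mul_pow_ne_zero hq hq) k
  have hP := qPoch_ne_zero h k
  have hq1 : 1 - q * q ^ k ≠ 0 := one_sub_mul_pow_ne_zero hq hq k
  have shift : qPoch (a * (b * q)) q k = qPoch (a * b) q k * (1 - a * b * q ^ k) / (1 - a * b) := by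
    rw [eq_div_iff h0, ← qPoch_succ, add_comm k 1, qPoch_add]
    rw [show a * (b * q) = a * b * q ^ 1 by ring]
    simp [qPoch, mul_comm]
  have hc : (k + 1).choose 2 = k + k.choose 2 := by
    rw [Nat.choose_succ_succ' k 1, Nat.choose_one_right]
  simp only [phiTerm, shift, qPoch_succ, hc, pow_add, pow_one, ← neg_mul b q, mul_pow]
  rw [mul_comm (q ^ k) q]
  generalize 1 - q * q ^ k = y at hq1 ⊢
  field_simp
  ring

/-- The difference of the two sides telescopes termwise; the boundary term vanishes at `k = 0`
because of `1 - q^k`, and at infinity by summability. -/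
lemma tsum_phiTerm_shift {a b q : ℂ} (hq : ‖q‖ < 1) (hb : ‖b‖ < 1)
    (h : ∀ j : ℕ, 1 - a * b * q ^ j ≠ 0) :
    (1 - a * b) * ∑' k, phiTerm a b q k = (1 - b) * ∑' k, phiTerm a (b * q) q k := by
  have s1 := summable_phiTerm hq hb h
  have s2 : Summable (phiTerm a (b * q) q) := by
    refine summable_phiTerm hq (by simpa using norm_mul_pow_lt_one hq hb 1) fun j => ?_
    simpa only [pow_succ', mul_assoc] using h (j + 1)
  have lim := ((s1.hasSum.mul_left (1 - a * b)).sub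
    (s2.hasSum.mul_left (1 - b))).tendsto_sum_nat
  simp only [phiTerm_telescope hq h] at lim
  simp only [Finset.sum_range_sub (fun k => -(1 - a * b) * phiTerm a b q k * (1 - q ^ k))] at lim
  have lim' : Tendsto (fun k => -(1 - a * b) * phiTerm a b q k * (1 - q ^ k)
      - -(1 - a * b) * phiTerm a b q 0 * (1 - q ^ 0)) atTop (𝓝 0) := by
    simpa using (s1.tendsto_atTop_zero.const_mul (-(1 - a * b))).mul
      ((tendsto_pow_atTop_nhds_zero_of_norm_lt_one hq).const_sub 1)
  exact sub_eq_zero.mp (tendsto_nhds_unique lim lim')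

lemma qPoch_mul_tsum_phiTerm {a b q : ℂ} (hq : ‖q‖ < 1) (hb : ‖b‖ < 1)
    (h : ∀ j : ℕ, 1 - a * b * q ^ j ≠ 0) (N : ℕ) :
    qPoch (a * b) q N * ∑' k, phiTerm a b q k =
      qPoch b q N * ∑' k, phiTerm a (b * q ^ N) q k := by
  induction N with
  | zero => simp [qPoch_zero]
  | succ N ih =>
    have := tsum_phiTerm_shift (a := a) hq (norm_mul_pow_lt_one hq hb N) fun j => by
      simpa only [pow_add, mul_assoc] using h (N + j)
    rw [qPoch_succ, qPoch_succ, mul_right_comm, ih, mul_right_comm, mul_assoc, mul_assoc (qPoch b q N),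
      mul_assoc a b, this, pow_succ, mul_assoc b]

/-- The limiting case `₁φ₁(a; ab; q, b)` of the `q`-Gauss sum. -/
theorem tsum_phiTerm {a b q : ℂ} (hq : ‖q‖ < 1) (hb : ‖b‖ < 1)
    (h : ∀ j : ℕ, 1 - a * b * q ^ j ≠ 0) :
    ∑' k, phiTerm a b q k = qPochInf b q / qPochInf (a * b) q := by
  obtain ⟨C, hC, hC'⟩ := exists_norm_phiTerm_le hq h
  -- As `b q^N → 0` only the term `k = 0` survives, so iterating the functional equation evaluates
  -- the sum.
  have lim : Tendsto (fun N : ℕ => ∑' k, phiTerm a (b * q ^ N) q k) atTop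
      (𝓝 (∑' k, if k = 0 then 1 else 0)) := by
    refine tendsto_tsum_of_dominated_convergence (bound := fun k => C * ‖b‖ ^ k)
      ((summable_geometric_of_lt_one (norm_nonneg b) hb).mul_left C) (fun k => ?_)
      (Eventually.of_forall fun N k => (hC' N k).trans ?_)
    · rcases eq_or_ne k 0 with rfl | hk
      · simp [phiTerm, qPoch_zero]
      · rw [if_neg hk]
        refine squeeze_zero_norm (fun N => hC' N k) ?_
        have : Tendsto (fun N : ℕ => b * q ^ N) atTop (𝓝 0) := by
          simpa using (tendsto_pow_atTop_nhds_zero_of_norm_lt_one hq).const_mul b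
        simpa [hk] using (this.norm.pow k).const_mul C
    · gcongr
      rw [norm_mul, norm_pow]
      exact mul_le_of_le_one_right (norm_nonneg _) (pow_le_one₀ (norm_nonneg _) hq.le)
  rw [tsum_ite_eq] at lim
  rw [eq_div_iff (qPochInf_ne_zero hq h), mul_comm]
  have := (tendsto_qPoch b hq).mul lim
  rw [mul_one] at this
  refine tendsto_nhds_unique ((tendsto_qPoch (a * b) hq).mul_const _) ?_
  simpa only [qPoch_mul_tsum_phiTerm hq hb h] using this

/-! ### The conjugate Bailey pair -/

/-- The sequence `δ_n / ((Q; Q)_{n-r} (Q; Q)_{n+r})` of the conjugate Bailey pair, with base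
`Q = q ^ 2`. -/
noncomputable def conjTerm (q : ℂ) (r n : ℕ) : ℂ :=
  if r ≤ n then q ^ (n * (n + 1)) * qPoch (-1) (q ^ 2) n
    / (qPoch (q ^ 2) (q ^ 2) (n - r) * qPoch (q ^ 2) (q ^ 2) (n + r)) else 0

lemma norm_sq_lt_one {q : ℂ} (hq : ‖q‖ < 1) : ‖q ^ 2‖ < 1 := by
  rw [norm_pow]; exact pow_lt_one₀ (norm_nonneg _) hq two_ne_zero

lemma qPoch_sq_ne_zero {q : ℂ} (hq : ‖q‖ < 1) (n : ℕ) : qPoch (q ^ 2) (q ^ 2) n ≠ 0 :=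
  qPoch_ne_zero (one_sub_mul_pow_ne_zero (norm_sq_lt_one hq) (norm_sq_lt_one hq)) n

lemma exists_norm_conjTerm_le {q : ℂ} (hq : ‖q‖ < 1) :
    ∃ C, 0 < C ∧ ∀ r n : ℕ, ‖conjTerm q r n‖ ≤ C * ‖q‖ ^ n := by
  have hQ := norm_sq_lt_one hq
  obtain ⟨A, hA, hA'⟩ := exists_norm_qPoch_le (-1) hQ
  obtain ⟨B, hB, hB'⟩ := exists_norm_inv_qPoch_le hQ (one_sub_mul_pow_ne_zero hQ hQ)
  refine ⟨A * (B * B), by positivity, fun r n => ?_⟩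
  rw [conjTerm]
  split_ifs with hr
  · rw [div_eq_mul_inv, mul_inv, norm_mul, norm_mul, norm_mul, norm_pow, mul_assoc,
      mul_comm (A * (B * B))]
    refine mul_le_mul (pow_le_pow_of_le_one (norm_nonneg _) hq.le (by nlinarith)) ?_
      (by positivity) (by positivity)
    gcongr
    exacts [hA' n, hB' _, hB' _]
  · rw [norm_zero]; positivity

lemma one_add_pow_ne_zero {q : ℂ} (hq : ‖q‖ < 1) (n : ℕ) : 1 + q ^ n ≠ 0 := by
  rcases eq_or_ne n 0 with rfl | hn
  · norm_num
  · intro h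
    have : ‖q ^ n‖ = 1 := by rw [eq_neg_of_add_eq_zero_right h]; simp
    rw [norm_pow] at this
    exact (pow_lt_one₀ (norm_nonneg _) hq hn).ne this

/-- After `n = r + k` this is the `₁φ₁` sum in base `Q = q²` with `a = -Q^r`, `b = -Q^(r+1)`, so `ab
= Q^(2r+1)`. -/
lemma hasSum_conjTerm {q : ℂ} (hq : ‖q‖ < 1) (r : ℕ) :
    HasSum (conjTerm q r) (2 * qPochInf (-q ^ 2) (q ^ 2) / qPochInf (q ^ 2) (q ^ 2)
      * (q ^ (r * (r + 1)) / (1 + q ^ (2 * r)))) := by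
  have hQ := norm_sq_lt_one hq
  set Q := q ^ 2 with hQdef
  have hb : ‖-Q * Q ^ r‖ < 1 := norm_mul_pow_lt_one hQ (by rwa [norm_neg]) r
  have hab : -Q ^ r * (-Q * Q ^ r) = Q * Q ^ (2 * r) := by ring
  have hne : ∀ j : ℕ, 1 - -Q ^ r * (-Q * Q ^ r) * Q ^ j ≠ 0 := by
    rw [hab]
    exact one_sub_mul_pow_ne_zero (norm_mul_pow_lt_one hQ hQ _) hQ
  have hs := (summable_phiTerm hQ hb hne).hasSum
  rw [tsum_phiTerm hQ hb hne, hab] at hs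
  have hs' := hs.mul_left (q ^ (r * (r + 1)) * qPoch (-1) Q r / qPoch Q Q (2 * r))
  have hQne : qPoch Q Q (2 * r) ≠ 0 := qPoch_sq_ne_zero hq _
  have hI : qPochInf (Q * Q ^ (2 * r)) Q ≠ 0 := qPochInf_ne_zero hQ
    (one_sub_mul_pow_ne_zero (norm_mul_pow_lt_one hQ hQ _) hQ)
  have h1 : (1 + Q ^ r) ≠ 0 := one_add_pow_ne_zero hQ r
  -- Both sides are `(-1;Q)_{r+1}`; this produces the factor `2/(1+q^(2r))`.
  have hneg : qPoch (-1) Q r * (1 + Q ^ r) = 2 * qPoch (-Q) Q r := by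
    have e1 := qPoch_succ (-1) Q r
    have e2 := qPoch_add (-1) Q 1 r
    rw [add_comm 1 r, e1] at e2
    simpa [qPoch, sub_neg_eq_add, one_add_one_eq_two] using e2
  have hval : q ^ (r * (r + 1)) * qPoch (-1) Q r / qPoch Q Q (2 * r)
      * (qPochInf (-Q * Q ^ r) Q / qPochInf (Q * Q ^ (2 * r)) Q) =
      2 * qPochInf (-Q) Q / qPochInf Q Q * (q ^ (r * (r + 1)) / (1 + q ^ (2 * r))) := by
    rw [qPochInf_eq_qPoch_mul (-Q) hQ r, qPochInf_eq_qPoch_mul Q hQ (2 * r), pow_mul q 2 r, ← hQdef,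
      ← mul_assoc 2, ← hneg]
    field_simp
  rw [hval] at hs'
  refine ((add_right_injective r).hasSum_iff fun n hn => ?_).mp (hs'.congr_fun ?_)
  · rw [conjTerm, if_neg]
    exact fun hr => hn ⟨n - r, by simp; omega⟩
  · intro k
    have hk : k.choose 2 * 2 + k = k * k := by
      induction k with
      | zero => rfl
      | succ k ih => rw [Nat.choose_succ_succ' k 1, Nat.choose_one_right]; linarith
    have hpow : q ^ ((r + k) * (r + k + 1)) = q ^ (r * (r + 1)) * (Q * Q ^ r) ^ k * Q ^ k.choose 2 := by
      rw [hQdef, ← pow_succ', ← pow_mul, ← pow_mul, ← pow_mul, ← pow_add, ← pow_add]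
      congr 1
      linarith
    have hP : qPoch (Q * Q ^ (2 * r)) Q k ≠ 0 := qPoch_ne_zero
      (one_sub_mul_pow_ne_zero (norm_mul_pow_lt_one hQ hQ _) hQ) k
    have hQk : qPoch Q Q k ≠ 0 := qPoch_sq_ne_zero hq _
    simp only [Function.comp_apply, conjTerm, le_add_iff_nonneg_right, zero_le, if_true, phiTerm,
      hab, Nat.add_sub_cancel_left, ← hQdef]
    rw [show r + k + r = 2 * r + k by ring, qPoch_add Q Q, qPoch_add (-1) Q, hpow, neg_one_mul,
      neg_mul, neg_neg]
    field_simp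

/-! ### The double series and its two iterated sums -/

/-- Makes the exponent a natural number and gives geometric decay in `|m|`. -/
lemma natAbs_le_mul_div_two (m : ℤ) : (m.natAbs : ℤ) ≤ m * (9 * m + 1) / 2 := by
  rw [Int.le_ediv_iff_mul_le two_pos, Int.natCast_natAbs]
  rcases abs_cases m with ⟨h, h'⟩ | ⟨h, h'⟩ <;> rw [h] <;>
    nlinarith [Int.le_self_sq m]

/-- The general term of the double series. -/
noncomputable def doubleTerm (q : ℂ) (n : ℕ) (m : ℤ) : ℂ :=
  (-1) ^ m * q ^ (m * (9 * m + 1) / 2) * conjTerm q (2 * m.natAbs) n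

lemma summable_pow_natAbs {x : ℝ} (h0 : 0 ≤ x) (h1 : x < 1) :
    Summable fun m : ℤ => x ^ m.natAbs := by
  refine Summable.of_nat_of_neg ?_ ?_ <;> simpa using summable_geometric_of_lt_one h0 h1

lemma summable_doubleTerm {q : ℂ} (hq : ‖q‖ < 1) :
    Summable fun p : ℕ × ℤ => doubleTerm q p.1 p.2 := by
  obtain ⟨C, hC, hC'⟩ := exists_norm_conjTerm_le hq
  refine Summable.of_norm_bounded
    (((summable_geometric_of_lt_one (norm_nonneg q) hq).mul_of_nonneg
      (summable_pow_natAbs (norm_nonneg q) hq) (fun _ => by positivity)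
      fun _ => by positivity).mul_left C) fun ⟨n, m⟩ => ?_
  obtain ⟨e, he⟩ := Int.eq_ofNat_of_zero_le ((Int.natCast_nonneg _).trans (natAbs_le_mul_div_two m))
  have hle := natAbs_le_mul_div_two m
  rw [he, Nat.cast_le] at hle
  have hqe : ‖q‖ ^ e ≤ ‖q‖ ^ m.natAbs := pow_le_pow_of_le_one (norm_nonneg _) hq.le hle
  simp only [doubleTerm, he, zpow_natCast, norm_mul, norm_zpow, norm_neg, norm_one, one_zpow,
    one_mul, norm_pow]
  calc ‖q‖ ^ e * ‖conjTerm q (2 * m.natAbs) n‖ ≤ ‖q‖ ^ m.natAbs * (C * ‖q‖ ^ n) := by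
        gcongr
        exact hC' _ _
    _ = C * (‖q‖ ^ n * ‖q‖ ^ m.natAbs) := by ring

lemma hasSum_doubleTerm_left (q : ℂ) (n : ℕ) :
    HasSum (doubleTerm q n)
      (∑ m ∈ Finset.Icc (-((n / 2 : ℕ) : ℤ)) ((n / 2 : ℕ) : ℤ), doubleTerm q n m) := by
  refine hasSum_sum_of_ne_finset_zero fun m hm => ?_
  rw [doubleTerm, conjTerm, if_neg, mul_zero]
  intro h
  exact hm (Finset.mem_Icc.mpr (by omega))

lemma doubleTerm_eq {q : ℂ} (hq : ‖q‖ < 1) {n : ℕ} {m : ℤ} (hm : 2 * m.natAbs ≤ n) :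
    doubleTerm q n m = (-1 : ℂ) ^ m * q ^ ((n : ℤ) * ((n : ℤ) + 1) + m * (9 * m + 1) / 2)
              * qPoch (-1) (q ^ 2) n
            / qPoch (q ^ 2) (q ^ 2) (2 * n)
            * qBinom (q ^ 2) (2 * n) ((n : ℤ) - 2 * m) := by
  obtain ⟨e, he⟩ := Int.eq_ofNat_of_zero_le ((Int.natCast_nonneg _).trans (natAbs_le_mul_div_two m))
  have hexp : (n : ℤ) * ((n : ℤ) + 1) + (e : ℤ) = ((n * (n + 1) + e : ℕ) : ℤ) := by push_cast; rfl
  have hprod : qPoch (q ^ 2) (q ^ 2) ((n : ℤ) - 2 * m).toNat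
      * qPoch (q ^ 2) (q ^ 2) (2 * n - ((n : ℤ) - 2 * m).toNat) =
      qPoch (q ^ 2) (q ^ 2) (n - 2 * m.natAbs) * qPoch (q ^ 2) (q ^ 2) (n + 2 * m.natAbs) := by
    rcases le_total 0 m with h | h
    · congr 2 <;> omega
    · rw [mul_comm]
      congr 2 <;> omega
  have h1 := qPoch_sq_ne_zero hq (2 * n)
  have h2 := qPoch_sq_ne_zero hq (n - 2 * m.natAbs)
  have h3 := qPoch_sq_ne_zero hq (n + 2 * m.natAbs)
  rw [doubleTerm, conjTerm, if_pos hm, qBinom, if_pos (by push_cast; omega), hprod, he, hexp,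
    zpow_natCast, zpow_natCast, pow_add]
  field_simp

/-- For `m < 0` the point is that `q^r/(1+q^(2r))` is invariant under `r ↦ -r`. At `q = 0`, terms
with `m ≠ 0` vanish on both sides. -/
lemma mul_pow_div_eq {q : ℂ} (hq : ‖q‖ < 1) (m : ℤ) :
    q ^ (m * (9 * m + 1) / 2) *
        (q ^ (2 * m.natAbs * (2 * m.natAbs + 1)) / (1 + q ^ (2 * (2 * m.natAbs)))) =
      q ^ (m * (17 * m + 5) / 2) / (1 + q ^ (4 * m)) := by
  rcases eq_or_ne m 0 with rfl | hm0
  · simp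
  rcases eq_or_ne q 0 with rfl | hq0
  · have h : m * (17 * m + 5) / 2 ≠ 0 := by
      have : 1 ≤ m * (17 * m + 5) / 2 := by
        rw [Int.le_ediv_iff_mul_le two_pos]
        rcases lt_or_gt_of_ne hm0 with h | h <;> nlinarith
      omega
    have h' : 2 * m.natAbs * (2 * m.natAbs + 1) ≠ 0 := by simp [hm0]
    rw [zero_pow h', zero_zpow _ h]
    simp
  rcases lt_or_gt_of_ne hm0 with hm | hm
  · obtain ⟨k, rfl⟩ : ∃ k : ℕ, m = -(k : ℤ) := ⟨m.natAbs, by omega⟩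
    have e1 : -(k : ℤ) * (17 * -(k : ℤ) + 5) / 2 + 4 * k
        = -(k : ℤ) * (9 * -(k : ℤ) + 1) / 2 + ((2 * k * (2 * k + 1) : ℕ) : ℤ) := by
      -- Moving the integers inside the division by 2 avoids any parity argument.
      rw [← Int.add_mul_ediv_right _ _ two_ne_zero, ← Int.add_mul_ediv_right _ _ two_ne_zero]
      congr 1
      push_cast
      ring
    have h1 : 1 + q ^ (4 * k) ≠ 0 := one_add_pow_ne_zero hq _
    have h2 : 1 + q ^ (4 * -(k : ℤ)) = (1 + q ^ (4 * k)) / q ^ (4 * k) := by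
      rw [mul_neg, zpow_neg, show (4 * (k : ℤ)) = ((4 * k : ℕ) : ℤ) by push_cast; rfl, zpow_natCast]
      field_simp
      ring
    rw [h2, Int.natAbs_neg, Int.natAbs_natCast, ← mul_assoc 2 2 k, div_div_eq_mul_div,
      ← mul_div_assoc, ← zpow_natCast q (2 * k * (2 * k + 1)), ← zpow_add₀ hq0, ← e1,
      zpow_add₀ hq0]
    norm_cast
  · obtain ⟨k, rfl⟩ : ∃ k : ℕ, m = (k : ℤ) := ⟨m.natAbs, by omega⟩
    have e1 : (k : ℤ) * (17 * (k : ℤ) + 5) / 2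
        = (k : ℤ) * (9 * (k : ℤ) + 1) / 2 + ((2 * k * (2 * k + 1) : ℕ) : ℤ) := by
      rw [← Int.add_mul_ediv_right _ _ two_ne_zero]
      congr 1
      push_cast
      ring
    rw [Int.natAbs_natCast, ← mul_assoc 2 2 k, ← mul_div_assoc,
      ← zpow_natCast q (2 * k * (2 * k + 1)), ← zpow_add₀ hq0, ← e1]
    norm_cast

lemma hasSum_doubleTerm_right {q : ℂ} (hq : ‖q‖ < 1) (m : ℤ) :
    HasSum (fun n => doubleTerm q n m)
      (2 * qPochInf (-q ^ 2) (q ^ 2) / qPochInf (q ^ 2) (q ^ 2)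
        * ((-1 : ℂ) ^ m * q ^ (m * (17 * m + 5) / 2) / (1 + q ^ (4 * m)))) := by
  have h := (hasSum_conjTerm hq (2 * m.natAbs)).mul_left ((-1) ^ m * q ^ (m * (9 * m + 1) / 2))
  rw [mul_left_comm, mul_assoc ((-1 : ℂ) ^ m), mul_pow_div_eq hq, ← mul_div_assoc] at h
  exact h

theorem mainTheorem5 (q : ℂ) (hq : ‖q‖ < 1) :
    Multipliable (fun j : ℕ => 1 - (-q ^ 2) * (q ^ 2) ^ j) ∧
    Multipliable (fun j : ℕ => 1 - q ^ 2 * (q ^ 2) ^ j) ∧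
    Summable (fun n : ℤ => (-1 : ℂ) ^ n * q ^ (n * (17 * n + 5) / 2) / (1 + q ^ (4 * n))) ∧
    HasSum
      (fun n : ℕ =>
        ∑ m ∈ Finset.Icc (-((n / 2 : ℕ) : ℤ)) ((n / 2 : ℕ) : ℤ),
          (-1 : ℂ) ^ m * q ^ ((n : ℤ) * ((n : ℤ) + 1) + m * (9 * m + 1) / 2)
              * qPoch (-1) (q ^ 2) n
            / qPoch (q ^ 2) (q ^ 2) (2 * n)
            * qBinom (q ^ 2) (2 * n) ((n : ℤ) - 2 * m))
      (2 * qPochInf (-q ^ 2) (q ^ 2) / qPochInf (q ^ 2) (q ^ 2)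
        * ∑' n : ℤ, (-1 : ℂ) ^ n * q ^ (n * (17 * n + 5) / 2) / (1 + q ^ (4 * n))) := by
  have hQ := norm_sq_lt_one hq
  have hQ' : ‖-q ^ 2‖ < 1 := by rwa [norm_neg]
  -- A nonzero prefactor lets summability of the bilateral series be read off from the interchanged
  -- sum.
  have hconst : 2 * qPochInf (-q ^ 2) (q ^ 2) / qPochInf (q ^ 2) (q ^ 2) ≠ 0 :=
    div_ne_zero (mul_ne_zero two_ne_zero
      (qPochInf_ne_zero hQ (one_sub_mul_pow_ne_zero hQ' hQ)))
      (qPochInf_ne_zero hQ (one_sub_mul_pow_ne_zero hQ hQ))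
  have hsum := (summable_doubleTerm hq).hasSum
  have hswap := HasSum.prod_fiberwise ((Equiv.prodComm ℤ ℕ).hasSum_iff.mpr hsum)
    (hasSum_doubleTerm_right hq)
  refine ⟨multipliable_qPoch_factor _ hQ, multipliable_qPoch_factor _ hQ,
    (summable_mul_left_iff hconst).mp hswap.summable, ?_⟩
  rw [← tsum_mul_left, hswap.tsum_eq]
  refine (hsum.prod_fiberwise (hasSum_doubleTerm_left q)).congr_fun fun n => ?_
  refine Finset.sum_congr rfl fun m hm => (doubleTerm_eq hq ?_).symm
  have := Finset.mem_Icc.mp hm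
  omega
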